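/- Let $q \ge 1$ be a fixed integer (not depending on $n$), and let $(K_n)$ and $(P_n)$ be sequences of natural numbers. Let $G_q(n,K_n,P_n)$ be the random graph on $n$ nodes in which each node is independently assigned a set of $K_n$ distinct keys, chosen uniformly at random among all $K_n$-element subsets of a pool of $P_n$ keys, and two distinct nodes are adjacent if and only if their key sets have at least $q$ keys in common. (This is the secure sensor network with the $q$-composite key predistribution scheme under full visibility.) Suppose that, as $n\to\infty$, $$K_n=\omega(\ln n)\qquad\text{and}\qquad K_n = o\!\left(\min\left\{\sqrt{P_n},\ \frac{P_n}{n}\right\}\right),$$ and that there is a constant $c>1$ such that $$\frac{1}{q!}\cdot\frac{K_n^{2q}}{P_n^{q}}\ \ge\ \frac{c\ln n}{n}\qquad\text{for all sufficiently large } n.$$ Then $G_q(n,K_n,P_n)$ is connected with high probability, that is, $\lim_{n\to\infty}\mathbb{P}\left[G_q(n,K_n,P_n)\text{ is connected}\right]=1$. -/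

import Mathlib

open Filter Topology MeasureTheory ProbabilityTheory Asymptotics

/-- The law of one key ring: the uniform distribution on the sets of exactly `K` distinct keys
from a pool of `P` keys. (It is the zero measure if `P < K`, when there is no such set.) -/
noncomputable def keyRingLaw (K P : ℕ) : Measure (Finset (Fin P)) :=
  uniformOn {S : Finset (Fin P) | S.card = K}

/-- The joint law of the key rings of `n` nodes: independent, each with law `keyRingLaw K P`. -/
noncomputable def keyAssignmentLaw (n K P : ℕ) : Measure (Fin n → Finset (Fin P)) :=
  Measure.pi fun _ : Fin n => keyRingLaw K P

/-- The `q`-composite intersection graph of a key assignment: two distinct nodes are adjacent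
if and only if they have at least `q` keys in common. -/
def qCompositeGraph (q : ℕ) {n P : ℕ} (S : Fin n → Finset (Fin P)) : SimpleGraph (Fin n) where
  Adj i j := i ≠ j ∧ q ≤ (S i ∩ S j).card
  symm := ⟨fun i j h => ⟨h.1.symm, by simpa only [Finset.inter_comm] using h.2⟩⟩
  loopless := ⟨fun _ h => h.1 rfl⟩

/-- The probability that the random graph `G_q(n, K, P)` is connected. -/
noncomputable def connectedProb (q n K P : ℕ) : ℝ :=
  (keyAssignmentLaw n K P).real {S | (qCompositeGraph q S).Connected}

/-! Connectivity is increasing in the key rings, so each uniform ring may be replaced by a smaller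
random one. Select every key independently with probability `x = t * K / P`, `t < 1` close to 1:
conditioning on the size shows that such a ring, cut off at size `K`, is dominated by a uniform one
(`sum_truncated_bernoulliWeight_le`). Since `K` dominates `ln n`, Chernoff makes an oversized ring
unlikely for all nodes at once.

In the Bernoulli model the keys are independent trials, each choosing a random set of nodes. The
edges are still dependent, but for a fixed cut the outcomes "this key is held by exactly `i` and
`j`" are distinct for distinct crossing pairs. Distinct outcomes of one trial are mutually
exclusive, which helps: the probability that no pair is joined is at most what independent edges
would give (`sum_prod_forall_hit_lt_le`).

What remains is the Erdős–Rényi union bound over cuts (`sum_cuts_le`), with edge probability at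
least about `K^(2q) / (q! P^q)` (`binomialBelow_le_exp`). The slack in `c > 1` pays for every power
of `t` lost. -/

/-- The weight of the finite set `S` when every element of `α` is selected independently with
probability `x`. -/
noncomputable def bernoulliWeight {α : Type*} [Fintype α] (x : ℝ) (S : Finset α) : ℝ :=
  x ^ S.card * (1 - x) ^ (Fintype.card α - S.card)

/-- The weight of the finite set `S` under the uniform distribution on sets with `K` elements. -/
noncomputable def uniformWeight {α : Type*} [Fintype α] (K : ℕ) (S : Finset α) : ℝ :=
  if S.card = K then ((Fintype.card α).choose K : ℝ)⁻¹ else 0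

/-! ### Bernoulli and uniform random subsets -/

section Weights

variable {α : Type*} [Fintype α]

theorem bernoulliWeight_nonneg {x : ℝ} (h0 : 0 ≤ x) (h1 : x ≤ 1) (S : Finset α) :
    0 ≤ bernoulliWeight x S :=
  mul_nonneg (pow_nonneg h0 _) (pow_nonneg (sub_nonneg.2 h1) _)

theorem uniformWeight_nonneg (K : ℕ) (S : Finset α) : 0 ≤ uniformWeight K S := by
  unfold uniformWeight; split_ifs <;> positivity

theorem sum_bernoulliWeight (x : ℝ) : ∑ S : Finset α, bernoulliWeight x S = 1 := by
  simp [bernoulliWeight, Fintype.sum_pow_mul_eq_add_pow]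

theorem bernoulliWeight_eq_prod [DecidableEq α] (x : ℝ) (S : Finset α) :
    bernoulliWeight x S = ∏ k, if k ∈ S then x else 1 - x := by
  rw [Finset.prod_ite, Finset.prod_const, Finset.prod_const, bernoulliWeight]
  congr 2
  · simp
  · rw [← Finset.card_compl]; congr 1; ext; simp

/-- Chernoff bound for the size of a Bernoulli random set. -/
theorem sum_bernoulliWeight_card_gt_le {x l : ℝ} (h0 : 0 ≤ x) (h1 : x ≤ 1) (hl : 0 ≤ l) (K : ℕ) :
    ∑ S : Finset α, (if S.card ≤ K then 0 else bernoulliWeight x S) ≤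
      Real.exp (Fintype.card α * x * (Real.exp l - 1) - l * K) := by
  calc ∑ S : Finset α, (if S.card ≤ K then 0 else bernoulliWeight x S)
      ≤ ∑ S : Finset α, Real.exp (-(l * K)) *
          ((x * Real.exp l) ^ S.card * (1 - x) ^ (Fintype.card α - S.card)) := by
        refine Finset.sum_le_sum fun S _ => ?_
        have hw := bernoulliWeight_nonneg h0 h1 S
        have : Real.exp (-(l * K)) *
            ((x * Real.exp l) ^ S.card * (1 - x) ^ (Fintype.card α - S.card)) =
            Real.exp (l * (S.card - K)) * bernoulliWeight x S := by
          rw [bernoulliWeight, mul_pow, ← Real.exp_nat_mul,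
            show l * ((S.card : ℝ) - K) = -(l * K) + S.card * l by ring, Real.exp_add]
          ring
        rw [this]
        split_ifs with h
        · positivity
        · refine le_mul_of_one_le_left hw (Real.one_le_exp (mul_nonneg hl ?_))
          push Not at h
          exact sub_nonneg.2 (by exact_mod_cast h.le)
    _ = Real.exp (-(l * K)) * (x * (Real.exp l - 1) + 1) ^ Fintype.card α := by
        rw [← Finset.mul_sum, Fintype.sum_pow_mul_eq_add_pow]; ring_nf
    _ ≤ Real.exp (-(l * K)) * Real.exp (x * (Real.exp l - 1)) ^ Fintype.card α := by
        have : 0 ≤ x * (Real.exp l - 1) := mul_nonneg h0 (sub_nonneg.2 (Real.one_le_exp hl))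
        gcongr
        exact Real.add_one_le_exp _
    _ = _ := by
        rw [← Real.exp_nat_mul, ← Real.exp_add]; ring_nf

/-- Double counting of the pairs `A ⊂ B` with `|A| = m`, `|B| = m + 1`, weighted by `g A`. -/
theorem sum_powersetCard_le_of_monotone [DecidableEq α] {g : Finset α → ℝ} (hg : Monotone g)
    (m : ℕ) :
    ((Fintype.card α - m : ℕ) : ℝ) * ∑ A ∈ Finset.powersetCard m Finset.univ, g A ≤
      (m + 1 : ℝ) * ∑ B ∈ Finset.powersetCard (m + 1) Finset.univ, g B := by
  have key : ∑ A ∈ Finset.powersetCard m (Finset.univ : Finset α), ∑ a ∈ Aᶜ, g A =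
      ∑ B ∈ Finset.powersetCard (m + 1) (Finset.univ : Finset α), ∑ a ∈ B, g (B.erase a) := by
    rw [Finset.sum_sigma', Finset.sum_sigma']
    refine Finset.sum_bij' (fun p _ => ⟨insert p.2 p.1, p.2⟩) (fun p _ => ⟨p.1.erase p.2, p.2⟩)
      ?_ ?_ ?_ ?_ ?_
    · rintro ⟨A, a⟩ h
      simp only [Finset.mem_sigma, Finset.mem_powersetCard_univ, Finset.mem_compl] at h ⊢
      simp [Finset.card_insert_of_notMem h.2, h.1]
    · rintro ⟨B, a⟩ h
      simp only [Finset.mem_sigma, Finset.mem_powersetCard_univ, Finset.mem_compl] at h ⊢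
      simp [Finset.card_erase_of_mem h.2, h.1]
    · rintro ⟨A, a⟩ h
      simp only [Finset.mem_sigma, Finset.mem_powersetCard_univ, Finset.mem_compl] at h
      simp [Finset.erase_insert h.2]
    · rintro ⟨B, a⟩ h
      simp only [Finset.mem_sigma, Finset.mem_powersetCard_univ] at h
      simp [Finset.insert_erase h.2]
    · rintro ⟨A, a⟩ h
      simp only [Finset.mem_sigma, Finset.mem_powersetCard_univ, Finset.mem_compl] at h
      simp [Finset.erase_insert h.2]
  rw [Finset.mul_sum, Finset.mul_sum]
  calc _ = ∑ A ∈ Finset.powersetCard m (Finset.univ : Finset α), ∑ a ∈ Aᶜ, g A := by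
        refine Finset.sum_congr rfl fun A hA => ?_
        rw [Finset.mem_powersetCard_univ] at hA
        simp only [Finset.sum_const, nsmul_eq_mul, Finset.card_compl, hA]
    _ = _ := key
    _ ≤ _ := by
        refine Finset.sum_le_sum fun B hB => ?_
        rw [Finset.mem_powersetCard_univ] at hB
        calc ∑ a ∈ B, g (B.erase a) ≤ ∑ a ∈ B, g B :=
              Finset.sum_le_sum fun a _ => hg (Finset.erase_subset _ _)
          _ = _ := by simp [hB]

/-- The mean of a monotone set function over sets with `m` elements increases with `m`. -/
theorem mean_powersetCard_mono [DecidableEq α] {g : Finset α → ℝ} (hg : Monotone g)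
    {m K : ℕ} (hm : m ≤ K) (hK : K ≤ Fintype.card α) :
    ((Fintype.card α).choose m : ℝ)⁻¹ * ∑ A ∈ Finset.powersetCard m Finset.univ, g A ≤
      ((Fintype.card α).choose K : ℝ)⁻¹ * ∑ A ∈ Finset.powersetCard K Finset.univ, g A := by
  induction K, hm using Nat.le_induction with
  | base => exact le_rfl
  | succ k _ ih =>
    refine (ih (by omega)).trans ?_
    have h := sum_powersetCard_le_of_monotone hg k
    -- This ratio of consecutive binomial coefficients turns the double count into a comparison of
    -- means.
    have hc : ((Fintype.card α).choose (k + 1) : ℝ) * (k + 1) =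
        (Fintype.card α).choose k * ((Fintype.card α - k : ℕ) : ℝ) := by
      exact_mod_cast Nat.choose_succ_right_eq (Fintype.card α) k
    have h1 : (0 : ℝ) < (Fintype.card α).choose k := by
      exact_mod_cast Nat.choose_pos (by omega)
    have h2 : (0 : ℝ) < (Fintype.card α).choose (k + 1) := by
      exact_mod_cast Nat.choose_pos hK
    have h3 : (0 : ℝ) < ((Fintype.card α - k : ℕ) : ℝ) := by
      exact_mod_cast (by omega : 0 < Fintype.card α - k)
    rw [inv_mul_le_iff₀ h1, ← mul_le_mul_iff_right₀ h3]
    refine h.trans (le_of_eq ?_)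
    field_simp
    linear_combination (∑ B ∈ Finset.powersetCard (k + 1) Finset.univ, g B) * hc

theorem sum_uniformWeight_mul (K : ℕ) (g : Finset α → ℝ) :
    ∑ S, uniformWeight K S * g S =
      ((Fintype.card α).choose K : ℝ)⁻¹ * ∑ A ∈ Finset.powersetCard K Finset.univ, g A := by
  classical
  rw [Finset.mul_sum, ← Finset.sum_filter_add_sum_filter_not Finset.univ (fun S => S.card = K)]
  rw [Finset.sum_eq_zero (s := Finset.univ.filter fun S : Finset α => ¬ S.card = K), add_zero]
  · refine Finset.sum_congr (by ext; simp) fun S hS => ?_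
    rw [Finset.mem_powersetCard_univ] at hS
    simp [uniformWeight, hS]
  · intro S hS
    simp only [Finset.mem_filter, Finset.mem_univ, true_and] at hS
    simp [uniformWeight, hS]

/-- A Bernoulli random set, restricted to the event that it has at most `K` elements, is
stochastically dominated by a uniform random set with `K` elements. -/
theorem sum_truncated_bernoulliWeight_le {x : ℝ} (h0 : 0 ≤ x) (h1 : x ≤ 1) {K : ℕ}
    (hK : K ≤ Fintype.card α) {g : Finset α → ℝ} (hg : Monotone g) (hg0 : ∀ S, 0 ≤ g S) :
    ∑ S, (if S.card ≤ K then bernoulliWeight x S else 0) * g S ≤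
      ∑ S, uniformWeight K S * g S := by
  classical
  set A : ℝ := ∑ S, uniformWeight K S * g S with hA
  have hA0 : 0 ≤ A := Finset.sum_nonneg fun S _ => mul_nonneg (uniformWeight_nonneg K S) (hg0 S)
  have fiber : ∀ f : Finset α → ℝ, ∑ S, f S =
      ∑ m ∈ Finset.range (Fintype.card α + 1),
        ∑ S ∈ Finset.powersetCard m Finset.univ, f S := by
    intro f
    rw [← Finset.powerset_univ, Finset.sum_powerset, Finset.card_univ]
  calc ∑ S, (if S.card ≤ K then bernoulliWeight x S else 0) * g S
      -- The weight is constant on sets of a given size. For size `m ≤ K` the mean of `g` is at most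
      -- its mean `A` at size `K`; larger sizes contribute nothing on the left.
      ≤ ∑ S : Finset α, bernoulliWeight x S * A := by
        rw [fiber, fiber]
        refine Finset.sum_le_sum fun m hm => ?_
        have hmc : m ≤ Fintype.card α := by simpa [Nat.lt_succ_iff] using hm
        by_cases hmK : m ≤ K
        · have hc : (0 : ℝ) < (Fintype.card α).choose m := by
            exact_mod_cast Nat.choose_pos hmc
          have h := mean_powersetCard_mono hg hmK hK
          rw [← sum_uniformWeight_mul K, ← hA, inv_mul_le_iff₀ hc] at h
          calc _ = x ^ m * (1 - x) ^ (Fintype.card α - m) *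
                ∑ S ∈ Finset.powersetCard m Finset.univ, g S := by
                rw [Finset.mul_sum]
                refine Finset.sum_congr rfl fun S hS => ?_
                rw [Finset.mem_powersetCard_univ] at hS
                simp [bernoulliWeight, hS, hmK]
            _ ≤ x ^ m * (1 - x) ^ (Fintype.card α - m) * ((Fintype.card α).choose m * A) :=
                mul_le_mul_of_nonneg_left h
                  (mul_nonneg (pow_nonneg h0 _) (pow_nonneg (sub_nonneg.2 h1) _))
            _ = ∑ S ∈ Finset.powersetCard m (Finset.univ : Finset α),
                x ^ m * (1 - x) ^ (Fintype.card α - m) * A := by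
                simp; ring
            _ = _ := by
                refine Finset.sum_congr rfl fun S hS => ?_
                rw [Finset.mem_powersetCard_univ] at hS
                simp [bernoulliWeight, hS]
        · refine (Finset.sum_eq_zero fun S hS => ?_).trans_le
            (Finset.sum_nonneg fun S _ => mul_nonneg (bernoulliWeight_nonneg h0 h1 S) hA0)
          rw [Finset.mem_powersetCard_univ] at hS
          simp [hS, hmK]
    _ = A := by rw [← Finset.sum_mul, sum_bernoulliWeight, one_mul]

end Weights

/-! ### Independent coordinates -/

section Products

variable {Ω : Type*} [Fintype Ω]

theorem sum_fin_succ_prod_mul {n : ℕ} (w : Ω → ℝ) (f : (Fin (n + 1) → Ω) → ℝ) :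
    ∑ S : Fin (n + 1) → Ω, (∏ i, w (S i)) * f S =
      ∑ s, w s * ∑ S : Fin n → Ω, (∏ i, w (S i)) * f (Fin.cons s S) := by
  rw [← (Fin.consEquiv fun _ : Fin (n + 1) => Ω).sum_comp, Fintype.sum_prod_type]
  refine Finset.sum_congr rfl fun s _ => ?_
  rw [Finset.mul_sum]
  refine Finset.sum_congr rfl fun S _ => ?_
  simp [Fin.consEquiv, Fin.prod_univ_succ, mul_assoc]

theorem sum_prod_eq_one {w : Ω → ℝ} (hw : ∑ s, w s = 1) (n : ℕ) :
    ∑ S : Fin n → Ω, ∏ i, w (S i) = 1 := by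
  rw [← Fintype.sum_pow, hw, one_pow]

/-- Stochastic domination of every coordinate gives stochastic domination of the product. -/
theorem sum_prod_mul_le_of_dominated [Preorder Ω] {a w : Ω → ℝ} (ha : ∀ s, 0 ≤ a s)
    (hw : ∀ s, 0 ≤ w s)
    (h : ∀ g : Ω → ℝ, Monotone g → (∀ s, 0 ≤ g s) → ∑ s, a s * g s ≤ ∑ s, w s * g s)
    (n : ℕ) (f : (Fin n → Ω) → ℝ) (hf : Monotone f) (hf0 : ∀ S, 0 ≤ f S) :
    ∑ S : Fin n → Ω, (∏ i, a (S i)) * f S ≤ ∑ S : Fin n → Ω, (∏ i, w (S i)) * f S := by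
  induction n with
  | zero => simp
  | succ n ih =>
    rw [sum_fin_succ_prod_mul, sum_fin_succ_prod_mul]
    -- The tail is replaced first, with the head fixed; the averaged tail is then a monotone
    -- nonnegative function of the head, to which `h` applies.
    refine le_trans (Finset.sum_le_sum fun s _ => mul_le_mul_of_nonneg_left
      (ih (fun S => f (Fin.cons s S)) ?_ fun S => hf0 _) (ha s)) (h _ ?_ ?_)
    · intro S S' hS
      refine hf ?_
      intro i
      cases i using Fin.cases with
      | zero => simp
      | succ i => simpa using hS i
    · intro s s' hs
      refine Finset.sum_le_sum fun S _ => mul_le_mul_of_nonneg_left (hf ?_)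
        (Finset.prod_nonneg fun i _ => hw _)
      intro i
      cases i using Fin.cases with
      | zero => simpa using hs
      | succ i => simp
    · intro s
      exact Finset.sum_nonneg fun S _ => mul_nonneg (Finset.prod_nonneg fun i _ => hw _) (hf0 _)

end Products

/-- This inequality later passes from exclusive events, whose probabilities add, to independent
ones, whose complements multiply. -/
theorem one_sub_sum_le_prod_one_sub {ι : Type*} (s : Finset ι) {f : ι → ℝ}
    (h0 : ∀ i ∈ s, 0 ≤ f i) (h1 : ∀ i ∈ s, f i ≤ 1) :
    1 - ∑ i ∈ s, f i ≤ ∏ i ∈ s, (1 - f i) := by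
  classical
  induction s using Finset.induction_on with
  | empty => simp
  | insert a s ha ih =>
    rw [Finset.sum_insert ha, Finset.prod_insert ha]
    have ih' := ih (fun i hi => h0 i (Finset.mem_insert_of_mem hi))
      (fun i hi => h1 i (Finset.mem_insert_of_mem hi))
    have hp : ∏ i ∈ s, (1 - f i) ≤ 1 := Finset.prod_le_one
      (fun i hi => sub_nonneg.2 (h1 i (Finset.mem_insert_of_mem hi)))
      (fun i hi => sub_le_self _ (h0 i (Finset.mem_insert_of_mem hi)))
    nlinarith [h0 a (Finset.mem_insert_self a s)]

/-! ### Binomial lower tails -/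

/-- The probability that `s` plus a binomial variable with parameters `N` and `p` is less
than `q`. -/
noncomputable def binomialBelow (q : ℕ) (p : ℝ) : ℕ → ℕ → ℝ
  | 0, s => if s < q then 1 else 0
  | N + 1, s => (1 - p) * binomialBelow q p N s + p * binomialBelow q p N (s + 1)

section BinomialBelow

variable {q : ℕ} {p : ℝ}

theorem binomialBelow_nonneg (h0 : 0 ≤ p) (h1 : p ≤ 1) (N s : ℕ) :
    0 ≤ binomialBelow q p N s := by
  induction N generalizing s with
  | zero => unfold binomialBelow; split_ifs <;> norm_num
  | succ N ih =>
    unfold binomialBelow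
    exact add_nonneg (mul_nonneg (sub_nonneg.2 h1) (ih _)) (mul_nonneg h0 (ih _))

theorem binomialBelow_succ_le (h0 : 0 ≤ p) (h1 : p ≤ 1) (N s : ℕ) :
    binomialBelow q p N (s + 1) ≤ binomialBelow q p N s := by
  induction N generalizing s with
  | zero => unfold binomialBelow; split_ifs <;> first | omega | norm_num
  | succ N ih =>
    unfold binomialBelow
    exact add_le_add (mul_le_mul_of_nonneg_left (ih _) (sub_nonneg.2 h1))
      (mul_le_mul_of_nonneg_left (ih _) h0)

/-- The upper tail of the binomial distribution is at least (essentially) its first term. -/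
theorem binomialBelow_le (h0 : 0 ≤ p) (h1 : p ≤ 1) (N d s : ℕ) (hs : s + d = q) :
    binomialBelow q p N s ≤ 1 - N.choose d * p ^ d * (1 - p) ^ N := by
  have hp : 0 ≤ 1 - p := sub_nonneg.2 h1
  induction N generalizing s d with
  | zero =>
    unfold binomialBelow
    cases d with
    | zero => simp [show ¬ s < q by omega]
    | succ d => simp; split_ifs <;> norm_num
  | succ N ih =>
    cases d with
    | zero =>
      unfold binomialBelow
      have hz : ∀ M s : ℕ, q ≤ s → binomialBelow q p M s = 0 := by
        intro M
        induction M with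
        | zero => intro s hs; simp [binomialBelow, hs]
        | succ M ihM => intro s hs; simp [binomialBelow, ihM s hs, ihM (s + 1) (by omega)]
      rw [hz _ _ (by omega), hz _ _ (by omega)]
      have : (1 - p) ^ (N + 1) ≤ 1 := pow_le_one₀ hp (by linarith)
      simp; linarith
    | succ d =>
      unfold binomialBelow
      have i1 := mul_le_mul_of_nonneg_left (ih (d + 1) s hs) hp
      have i2 := mul_le_mul_of_nonneg_left (ih d (s + 1) (by omega)) h0
      -- Giving away one factor `1 - p` equalizes the exponents for Pascal's rule; this is why the
      -- bound has exponent `N` instead of `N - d`.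
      have i3 : (N.choose d : ℝ) * p ^ (d + 1) * (1 - p) ^ (N + 1) ≤
          N.choose d * p ^ (d + 1) * (1 - p) ^ N := by
        refine mul_le_mul_of_nonneg_left ?_ (by positivity)
        exact pow_le_pow_of_le_one hp (by linarith) (Nat.le_succ N)
      rw [Nat.choose_succ_succ]
      push_cast
      calc _ ≤ _ := add_le_add i1 i2
        _ = 1 - (N.choose d * p ^ (d + 1) * (1 - p) ^ N +
              N.choose (d + 1) * p ^ (d + 1) * (1 - p) ^ (N + 1)) := by ring
        _ ≤ 1 - (N.choose d * p ^ (d + 1) * (1 - p) ^ (N + 1) +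
              N.choose (d + 1) * p ^ (d + 1) * (1 - p) ^ (N + 1)) := by linarith
        _ = _ := by ring

end BinomialBelow

/-! ### Negative dependence from mutually exclusive outcomes -/

section NegativeDependence

variable {Ω ι : Type*} [Fintype Ω] {μ : Ω → ℝ} {E : Finset ι} {p : ℝ} {v : ι → Ω}

/-- One random trial decreases the product of the `x e` at least as much as independent trials, one
for each `e ∈ E`, each of which replaces `x e` by `y e` with probability `p`. -/
theorem sum_prod_ite_le (hμ : ∀ w, 0 ≤ μ w) (hμ1 : ∑ w, μ w = 1) (hit : Ω → ι → Prop)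
    [∀ w e, Decidable (hit w e)] (hp0 : 0 ≤ p) (hp1 : p ≤ 1) (hv : Set.InjOn v E)
    (hvp : ∀ e ∈ E, p ≤ μ (v e)) (hvh : ∀ e ∈ E, hit (v e) e) {x y : ι → ℝ}
    (hy : ∀ e, 0 ≤ y e) (hyx : ∀ e, y e ≤ x e) :
    ∑ w, μ w * ∏ e ∈ E, (if hit w e then y e else x e) ≤
      ∏ e ∈ E, ((1 - p) * x e + p * y e) := by
  classical
  have hx : ∀ e, 0 ≤ x e := fun e => (hy e).trans (hyx e)
  -- Relative loss of the factor `e` when hit. If `x e = 0`, then `y e = 0` too, and the value 1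
  -- coming from division by zero is harmless.
  set r : ι → ℝ := fun e => 1 - y e / x e with hr
  have hry : ∀ e, y e = x e * (1 - r e) := by
    intro e
    by_cases h : x e = 0
    · have := hyx e; rw [h] at this ⊢; linarith [hy e]
    · simp only [hr]; field_simp; ring
  have hr0 : ∀ e, 0 ≤ r e := fun e => sub_nonneg.2 (div_le_one_of_le₀ (hyx e) (hx e))
  have hr1 : ∀ e, r e ≤ 1 := fun e => sub_le_self _ (div_nonneg (hy e) (hx e))
  set X := ∏ e ∈ E, x e with hX
  have hX0 : 0 ≤ X := Finset.prod_nonneg fun e _ => hx e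
  set Y : Ω → ℝ := fun w => ∏ e ∈ E, (if hit w e then y e else x e) with hY
  have hYX : ∀ w, Y w ≤ X := fun w => Finset.prod_le_prod
    (fun e _ => by split_ifs; exacts [hy e, hx e]) (fun e _ => by split_ifs; exacts [hyx e, le_rfl])
  have hYv : ∀ e ∈ E, Y (v e) ≤ X * (1 - r e) := by
    intro e he
    calc Y (v e) ≤ ∏ e' ∈ E, x e' * (if e' = e then 1 - r e else 1) := by
          refine Finset.prod_le_prod (fun e _ => by split_ifs; exacts [hy e, hx e]) ?_
          intro e' _
          by_cases h : e' = e
          · subst h; simp [hvh e' he, ← hry]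
          · simp only [h, if_false, mul_one]; split_ifs; exacts [hyx e', le_rfl]
      _ = X * (1 - r e) := by rw [Finset.prod_mul_distrib, Finset.prod_ite_eq' E e, if_pos he]
  -- Injectivity of `v` makes the outcomes `v e` disjoint parts of the sample space, so their
  -- expected losses add up; other outcomes lose a nonnegative amount.
  have hsum : ∑ e ∈ E, p * (X * r e) ≤ ∑ w, μ w * (X - Y w) := by
    calc ∑ e ∈ E, p * (X * r e) ≤ ∑ e ∈ E, μ (v e) * (X - Y (v e)) := by
          refine Finset.sum_le_sum fun e he => ?_
          exact mul_le_mul (hvp e he) (by linarith [hYv e he]) (mul_nonneg hX0 (hr0 e)) (hμ _)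
      _ = ∑ w ∈ E.image v, μ w * (X - Y w) :=
          (Finset.sum_image (f := fun w => μ w * (X - Y w)) hv).symm
      _ ≤ _ := Finset.sum_le_sum_of_subset_of_nonneg (Finset.subset_univ _)
          fun w _ _ => mul_nonneg (hμ w) (sub_nonneg.2 (hYX w))
  have hsplit : ∑ w, μ w * (X - Y w) = X - ∑ w, μ w * Y w := by
    simp only [mul_sub, Finset.sum_sub_distrib, ← Finset.sum_mul, hμ1, one_mul]
  calc ∑ w, μ w * Y w ≤ X - ∑ e ∈ E, p * (X * r e) := by linarith
    _ = X * (1 - ∑ e ∈ E, p * r e) := by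
        rw [mul_sub, mul_one, Finset.mul_sum]
        congr 1
        exact Finset.sum_congr rfl fun e _ => by ring
    _ ≤ X * ∏ e ∈ E, (1 - p * r e) := by
        refine mul_le_mul_of_nonneg_left (one_sub_sum_le_prod_one_sub E ?_ ?_) hX0
        · exact fun e _ => mul_nonneg hp0 (hr0 e)
        · exact fun e _ => mul_le_one₀ hp1 (hr0 e) (hr1 e)
    _ = _ := by
        rw [← Finset.prod_mul_distrib]
        refine Finset.prod_congr rfl fun e _ => ?_
        rw [hry e]; ring

/-- If the elements of `E` have distinct outcomes `v e` of probability at least `p` that hit them,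
then in `N` independent trials the events that `e` is hit less than `q` times are bounded as if the
trials were independent for different `e`. -/
theorem sum_prod_forall_hit_lt_le (hμ : ∀ w, 0 ≤ μ w) (hμ1 : ∑ w, μ w = 1)
    (hit : Ω → ι → Prop) [∀ w e, Decidable (hit w e)] (hp0 : 0 ≤ p) (hp1 : p ≤ 1)
    (hv : Set.InjOn v E) (hvp : ∀ e ∈ E, p ≤ μ (v e)) (hvh : ∀ e ∈ E, hit (v e) e)
    (q N : ℕ) (s : ι → ℕ) :
    ∑ w : Fin N → Ω, (∏ k, μ (w k)) *
        (if ∀ e ∈ E, s e + (∑ k, if hit (w k) e then 1 else 0) < q then 1 else 0) ≤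
      ∏ e ∈ E, binomialBelow q p N (s e) := by
  induction N generalizing s with
  | zero =>
    simp only [Finset.univ_eq_empty, Finset.prod_empty, Finset.sum_empty, add_zero, one_mul,
      Finset.univ_unique, Finset.sum_singleton, binomialBelow]
    split_ifs with h
    · rw [Finset.prod_eq_one]
      intro e he
      simp [h e he]
    · exact Finset.prod_nonneg fun e _ => by split_ifs <;> norm_num
  | succ N ih =>
    rw [sum_fin_succ_prod_mul]
    simp only [Fin.sum_univ_succ, Fin.cons_zero, Fin.cons_succ, ← add_assoc]
    calc _ ≤ ∑ w, μ w * ∏ e ∈ E, binomialBelow q p N (s e + if hit w e then 1 else 0) :=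
          Finset.sum_le_sum fun w _ => mul_le_mul_of_nonneg_left
            (ih fun e => s e + if hit w e then 1 else 0) (hμ w)
      _ = ∑ w, μ w * ∏ e ∈ E, (if hit w e then binomialBelow q p N (s e + 1)
            else binomialBelow q p N (s e)) := by
          refine Finset.sum_congr rfl fun w _ => ?_
          congr 1
          refine Finset.prod_congr rfl fun e _ => ?_
          split_ifs <;> rfl
      _ ≤ _ := sum_prod_ite_le hμ hμ1 hit hp0 hp1 hv hvp hvh
            (fun e => binomialBelow_nonneg hp0 hp1 _ _) (fun e => binomialBelow_succ_le hp0 hp1 _ _)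

end NegativeDependence

/-! ### Cuts in the Bernoulli model -/

/-- Exchange of the roles of nodes and keys in a key assignment. -/
def transposeAssignment (α β : Type*) [Fintype α] [DecidableEq α] [Fintype β] [DecidableEq β] :
    (α → Finset β) ≃ (β → Finset α) where
  toFun S k := Finset.univ.filter fun i => k ∈ S i
  invFun N i := Finset.univ.filter fun k => i ∈ N k
  left_inv S := by ext; simp
  right_inv N := by ext; simp

/-- In the Bernoulli model, the probability that there is no edge between `T` and its
complement. -/
theorem sum_bernoulliWeight_cut_le {n P : ℕ} {x : ℝ} (h0 : 0 ≤ x) (h1 : x ≤ 1) (q : ℕ)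
    (T : Finset (Fin n)) :
    ∑ S : Fin n → Finset (Fin P), (∏ i, bernoulliWeight x (S i)) *
        (if ∀ i ∈ T, ∀ j ∉ T, (S i ∩ S j).card < q then 1 else 0) ≤
      binomialBelow q (x ^ 2 * (1 - x) ^ (n - 2)) P 0 ^ (T.card * (n - T.card)) := by
  have hx1 : 0 ≤ 1 - x := sub_nonneg.2 h1
  rw [← (transposeAssignment (Fin P) (Fin n)).sum_comp]
  have hcount : ∀ (N : Fin P → Finset (Fin n)) (i j : Fin n),
      (transposeAssignment (Fin P) (Fin n) N i ∩ transposeAssignment (Fin P) (Fin n) N j).card =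
        ∑ k, if i ∈ N k ∧ j ∈ N k then 1 else 0 := by
    intro N i j
    rw [← Finset.card_filter]
    congr 1
    ext k
    simp [transposeAssignment]
  have hweight : ∀ N : Fin P → Finset (Fin n),
      ∏ i, bernoulliWeight x (transposeAssignment (Fin P) (Fin n) N i) =
        ∏ k, bernoulliWeight x (N k) := by
    intro N
    simp only [bernoulliWeight_eq_prod]
    rw [Finset.prod_comm]
    simp [transposeAssignment]
  -- Each key is a trial whose outcome is its set of holders. The distinguished outcome for a
  -- crossing pair is that the pair is the exact set of holders; a crossing pair is recovered from
  -- its unordered form because only one end lies in `T`.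
  have main := sum_prod_forall_hit_lt_le (μ := bernoulliWeight (α := Fin n) x)
    (E := T ×ˢ Tᶜ) (p := x ^ 2 * (1 - x) ^ (n - 2)) (v := fun e => {e.1, e.2})
    (bernoulliWeight_nonneg h0 h1) (sum_bernoulliWeight x)
    (fun N e => e.1 ∈ N ∧ e.2 ∈ N) (by positivity)
    (mul_le_one₀ (pow_le_one₀ h0 h1) (by positivity) (pow_le_one₀ hx1 (by linarith)))
    ?_ ?_ ?_ q P (fun _ => 0)
  · simp only [Finset.prod_const, Finset.card_product, Finset.card_compl, Fintype.card_fin] at main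
    refine le_trans (le_of_eq ?_) main
    refine Finset.sum_congr rfl fun N _ => ?_
    rw [hweight]
    congr 1
    simp only [hcount, zero_add, Finset.mem_product, Finset.mem_compl]
    split_ifs with h h' h'
    · rfl
    · exact (h' fun e he => h e.1 he.1 e.2 he.2).elim
    · exact (h fun i hi j hj => h' (i, j) ⟨hi, hj⟩).elim
    · rfl
  · rintro ⟨i, j⟩ he ⟨i', j'⟩ he' h
    simp only [Finset.coe_product, Set.mem_prod, Finset.mem_coe, Finset.mem_compl] at he he'
    simp only at h
    have hi : i ∈ ({i', j'} : Finset (Fin n)) := h ▸ by simp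
    have hj : j ∈ ({i', j'} : Finset (Fin n)) := h ▸ by simp
    simp only [Finset.mem_insert, Finset.mem_singleton] at hi hj
    have : i = i' := hi.resolve_right fun h => he'.2 (h ▸ he.1)
    have : j = j' := hj.resolve_left fun h => he.2 (h ▸ he'.1)
    simp [*]
  · rintro ⟨i, j⟩ he
    simp only [Finset.mem_product, Finset.mem_compl] at he
    have hij : i ≠ j := fun h => he.2 (h ▸ he.1)
    simp [bernoulliWeight, Finset.card_pair hij]
  · intro e _
    simp

theorem sum_prod_mul_apply {Ω : Type*} [Fintype Ω] {n : ℕ} {w : Ω → ℝ} (hw : ∑ s, w s = 1)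
    (g : Ω → ℝ) (i₀ : Fin n) :
    ∑ S : Fin n → Ω, (∏ i, w (S i)) * g (S i₀) = ∑ s, w s * g s := by
  classical
  calc ∑ S : Fin n → Ω, (∏ i, w (S i)) * g (S i₀)
      = ∑ S : Fin n → Ω, ∏ i, (w (S i) * if i = i₀ then g (S i) else 1) := by
        refine Finset.sum_congr rfl fun S _ => ?_
        rw [Finset.prod_mul_distrib, Finset.prod_ite_eq' Finset.univ i₀]
        simp
    _ = ∏ i, ∑ s, (w s * if i = i₀ then g s else 1) := by
        rw [Finset.prod_univ_sum (fun _ => Finset.univ)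
          (fun i s => w s * if i = i₀ then g s else 1), Fintype.piFinset_univ]
    _ = ∏ i, if i = i₀ then ∑ s, w s * g s else 1 := by
        refine Finset.prod_congr rfl fun i _ => ?_
        split_ifs <;> simp [hw]
    _ = _ := by simp

/-! ### The uniform model as a weighted sum, and monotonicity of connectivity -/

theorem isProbabilityMeasure_keyRingLaw {K P : ℕ} (h : K ≤ P) :
    IsProbabilityMeasure (keyRingLaw K P) := by
  refine isProbabilityMeasure_uniformOn (Set.toFinite _) ?_
  obtain ⟨S, -, hS⟩ := Finset.exists_subset_card_eq (s := (Finset.univ : Finset (Fin P)))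
    (n := K) (by simpa using h)
  exact ⟨S, hS⟩

theorem keyRingLaw_real_singleton (K P : ℕ) (S : Finset (Fin P)) :
    (keyRingLaw K P).real {S} = uniformWeight K S := by
  have h1 : {S : Finset (Fin P) | S.card = K} =
      (↑(Finset.powersetCard K (Finset.univ : Finset (Fin P))) : Set (Finset (Fin P))) := by
    ext; simp
  have h2 : ({S} : Set (Finset (Fin P))) = (↑({S} : Finset (Finset (Fin P))) : Set _) := by simp
  rw [keyRingLaw, h1, h2, measureReal_def, uniformOn_apply_finset, uniformWeight]
  split_ifs with h
  · have : Finset.powersetCard K (Finset.univ : Finset (Fin P)) ∩ {S} = {S} := by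
      ext A; simp only [Finset.mem_inter, Finset.mem_powersetCard_univ, Finset.mem_singleton]
      exact ⟨fun h => h.2, fun h' => ⟨h' ▸ h, h'⟩⟩
    simp [this]
  · have : Finset.powersetCard K (Finset.univ : Finset (Fin P)) ∩ {S} = ∅ := by
      ext A; simp only [Finset.mem_inter, Finset.mem_powersetCard_univ, Finset.mem_singleton,
        Finset.notMem_empty, iff_false]
      exact fun h' => h (h'.2 ▸ h'.1)
    simp [this]

/-- The indicator function of the event that the graph is connected. -/
noncomputable def connectedIndicator (q : ℕ) {n P : ℕ} (S : Fin n → Finset (Fin P)) : ℝ :=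
  Set.indicator {S | (qCompositeGraph q S).Connected} (fun _ => 1) S

theorem connectedProb_eq_sum {q n K P : ℕ} (h : K ≤ P) :
    connectedProb q n K P = ∑ S : Fin n → Finset (Fin P), (∏ i, uniformWeight K (S i)) *
      connectedIndicator q S := by
  classical
  have := isProbabilityMeasure_keyRingLaw h
  have hset : {S : Fin n → Finset (Fin P) | (qCompositeGraph q S).Connected} =
      ↑(Finset.univ.filter fun S : Fin n → Finset (Fin P) => (qCompositeGraph q S).Connected) := by
    ext; simp
  unfold connectedProb
  have : IsProbabilityMeasure (keyAssignmentLaw n K P) := by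
    unfold keyAssignmentLaw; infer_instance
  rw [hset, ← sum_measureReal_singleton, Finset.sum_filter]
  refine Finset.sum_congr rfl fun S _ => ?_
  have hS : (keyAssignmentLaw n K P).real {S} = ∏ i, uniformWeight K (S i) := by
    rw [measureReal_def, keyAssignmentLaw, Measure.pi_singleton, ENNReal.toReal_prod]
    exact Finset.prod_congr rfl fun i _ => keyRingLaw_real_singleton K P (S i)
  rw [hS, connectedIndicator, Set.indicator_apply, mul_ite, mul_one, mul_zero]
  rfl

theorem connectedProb_le_one {q n K P : ℕ} (h : K ≤ P) : connectedProb q n K P ≤ 1 := by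
  have := isProbabilityMeasure_keyRingLaw h
  have : IsProbabilityMeasure (keyAssignmentLaw n K P) := by
    unfold keyAssignmentLaw; infer_instance
  exact measureReal_le_one

theorem qCompositeGraph_mono (q : ℕ) {n P : ℕ} :
    Monotone fun S : Fin n → Finset (Fin P) => qCompositeGraph q S := by
  intro S S' h i j hij
  exact ⟨hij.1, hij.2.trans (Finset.card_le_card (Finset.inter_subset_inter (h i) (h j)))⟩

theorem connectedIndicator_nonneg (q : ℕ) {n P : ℕ} (S : Fin n → Finset (Fin P)) :
    0 ≤ connectedIndicator q S :=
  Set.indicator_nonneg (fun _ _ => zero_le_one) S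

theorem connectedIndicator_mono (q : ℕ) {n P : ℕ} :
    Monotone (connectedIndicator q : (Fin n → Finset (Fin P)) → ℝ) := by
  intro S S' h
  by_cases hS : (qCompositeGraph q S).Connected
  · have hS' := hS.mono (qCompositeGraph_mono q h)
    simp [connectedIndicator, hS, hS']
  · refine le_trans (le_of_eq ?_) (connectedIndicator_nonneg q S')
    simp [connectedIndicator, hS]

/-- Key rings of a Bernoulli model, restricted to rings with at most `K` keys, are dominated by
uniform key rings of size `K`. -/
theorem sum_truncated_connectedIndicator_le {q n K P : ℕ} (hK : K ≤ P) {x : ℝ} (h0 : 0 ≤ x)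
    (h1 : x ≤ 1) :
    ∑ S : Fin n → Finset (Fin P), (∏ i, if (S i).card ≤ K then bernoulliWeight x (S i) else 0) *
      connectedIndicator q S ≤ connectedProb q n K P := by
  rw [connectedProb_eq_sum hK]
  have hdom (g : Finset (Fin P) → ℝ) (hg : Monotone g) (hg0 : ∀ S, 0 ≤ g S) :=
    sum_truncated_bernoulliWeight_le h0 h1 (K := K) (by simpa using hK) hg hg0
  have ha (s : Finset (Fin P)) : 0 ≤ if s.card ≤ K then bernoulliWeight x s else 0 := by
    split_ifs
    exacts [bernoulliWeight_nonneg h0 h1 s, le_rfl]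
  exact sum_prod_mul_le_of_dominated ha (uniformWeight_nonneg K) hdom n (connectedIndicator q)
    (connectedIndicator_mono q) (connectedIndicator_nonneg q)

/-! ### Union bound over oversized rings and empty cuts -/

/-- A disconnected graph has an isolated nonempty set of at most half of the vertices. -/
theorem exists_isolated_of_not_connected {n : ℕ} [NeZero n] {G : SimpleGraph (Fin n)}
    (hG : ¬ G.Connected) :
    ∃ T : Finset (Fin n), T.Nonempty ∧ 2 * T.card ≤ n ∧ ∀ i ∈ T, ∀ j ∉ T, ¬ G.Adj i j := by
  classical
  obtain ⟨u, v, huv⟩ : ∃ u v, ¬ G.Reachable u v := by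
    by_contra h
    push Not at h
    exact hG ⟨h⟩
  set T : Finset (Fin n) := Finset.univ.filter fun w => G.Reachable u w with hT
  have hadj : ∀ i ∈ T, ∀ j ∉ T, ¬ G.Adj i j := by
    intro i hi j hj hij
    simp only [hT, Finset.mem_filter, Finset.mem_univ, true_and] at hi hj
    exact hj (hi.trans hij.reachable)
  by_cases hc : 2 * T.card ≤ n
  · exact ⟨T, ⟨u, by simp [hT]⟩, hc, hadj⟩
  · refine ⟨Tᶜ, ⟨v, by simpa [hT] using huv⟩, ?_, ?_⟩
    · rw [Finset.card_compl, Fintype.card_fin]; omega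
    · intro i hi j hj hij
      rw [Finset.mem_compl] at hi
      rw [Finset.mem_compl, not_not] at hj
      exact hadj j hj i hi hij.symm

/-- A lower bound for the connectivity probability, with a free selection probability `x` for the
Bernoulli model and a free parameter `l` for the Chernoff bound. -/
theorem one_sub_connectedProb_le {q n K P : ℕ} [NeZero n] (hK : K ≤ P) {x l : ℝ} (h0 : 0 ≤ x)
    (h1 : x ≤ 1) (hl : 0 ≤ l) :
    1 - connectedProb q n K P ≤ n * Real.exp (P * x * (Real.exp l - 1) - l * K) +
      ∑ T : Finset (Fin n) with T.Nonempty ∧ 2 * T.card ≤ n,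
        binomialBelow q (x ^ 2 * (1 - x) ^ (n - 2)) P 0 ^ (T.card * (n - T.card)) := by
  classical
  set w : Finset (Fin P) → ℝ := bernoulliWeight x with hw
  have hw0 : ∀ S, 0 ≤ w S := bernoulliWeight_nonneg h0 h1
  have hw1 : ∑ S, w S = 1 := sum_bernoulliWeight x
  set conn : (Fin n → Finset (Fin P)) → ℝ :=
    connectedIndicator q with hconn
  set big : Finset (Fin P) → ℝ := fun S => if S.card ≤ K then 0 else 1 with hbig
  set cut : Finset (Fin n) → (Fin n → Finset (Fin P)) → ℝ :=
    fun T S => if ∀ i ∈ T, ∀ j ∉ T, (S i ∩ S j).card < q then 1 else 0 with hcut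
  set F : Finset (Finset (Fin n)) :=
    Finset.univ.filter fun T => T.Nonempty ∧ 2 * T.card ≤ n with hF
  have hbig0 : ∀ S, 0 ≤ big S := fun S => by simp only [hbig]; split_ifs <;> norm_num
  have hcut0 : ∀ T S, 0 ≤ cut T S := fun T S => by simp only [hcut]; split_ifs <;> norm_num
  have hconn0 : ∀ S, 0 ≤ conn S := connectedIndicator_nonneg q
  have hdom : ∑ S : Fin n → Finset (Fin P), (∏ i, if (S i).card ≤ K then w (S i) else 0) * conn S ≤
      connectedProb q n K P := sum_truncated_connectedIndicator_le hK h0 h1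
  -- An oversized ring or a disconnected graph makes some subtracted indicator equal to 1, so the
  -- left side is at most 0. Otherwise the truncation changes nothing and `conn S = 1`.
  have hpoint : ∀ S : Fin n → Finset (Fin P),
      (∏ i, w (S i)) * (1 - ∑ i, big (S i) - ∑ T ∈ F, cut T S) ≤
        (∏ i, if (S i).card ≤ K then w (S i) else 0) * conn S := by
    intro S
    have hW : 0 ≤ ∏ i, w (S i) := Finset.prod_nonneg fun i _ => hw0 _
    have hB : 0 ≤ ∑ i, big (S i) := Finset.sum_nonneg fun i _ => hbig0 _
    have hC : 0 ≤ ∑ T ∈ F, cut T S := Finset.sum_nonneg fun T _ => hcut0 _ _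
    have hR : 0 ≤ (∏ i, if (S i).card ≤ K then w (S i) else 0) * conn S :=
      mul_nonneg (Finset.prod_nonneg fun i _ => by split_ifs; exacts [hw0 _, le_rfl]) (hconn0 _)
    by_cases hs : ∀ i, (S i).card ≤ K
    · by_cases hg : (qCompositeGraph q S).Connected
      · have : (∏ i, if (S i).card ≤ K then w (S i) else 0) = ∏ i, w (S i) :=
          Finset.prod_congr rfl fun i _ => if_pos (hs i)
        rw [this]
        refine mul_le_mul_of_nonneg_left ?_ hW
        have : conn S = 1 := by simp [hconn, connectedIndicator, hg]
        linarith
      · refine le_trans (mul_nonpos_of_nonneg_of_nonpos hW ?_) hR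
        obtain ⟨T, hT0, hT1, hT⟩ := exists_isolated_of_not_connected hg
        have h1 : cut T S = 1 := by
          refine if_pos fun i hi j hj => ?_
          by_contra hq
          exact hT i hi j hj ⟨fun h => hj (h ▸ hi), not_lt.1 hq⟩
        have := Finset.single_le_sum (f := fun T => cut T S) (fun T _ => hcut0 T S)
          (show T ∈ F by simp [hF, hT0, hT1])
        simp only [h1] at this
        linarith
    · push Not at hs
      obtain ⟨i, hi⟩ := hs
      refine le_trans (mul_nonpos_of_nonneg_of_nonpos hW ?_) hR
      have := Finset.single_le_sum (f := fun i => big (S i)) (fun i _ => hbig0 _)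
        (Finset.mem_univ i)
      simp only [hbig, not_le.2 hi, if_false] at this
      simp only [hbig] at hB ⊢
      linarith
  have hsum : ∑ S : Fin n → Finset (Fin P),
      (∏ i, w (S i)) * (1 - ∑ i, big (S i) - ∑ T ∈ F, cut T S) =
      1 - n * ∑ s, w s * big s -
        ∑ T ∈ F, ∑ S : Fin n → Finset (Fin P), (∏ i, w (S i)) * cut T S := by
    simp only [mul_sub, mul_one, Finset.sum_sub_distrib, Finset.mul_sum]
    rw [sum_prod_eq_one hw1, Finset.sum_comm, Finset.sum_comm (t := F)]
    simp only [sum_prod_mul_apply hw1 big]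
    simp [Finset.mul_sum]
  have hch : ∑ s, w s * big s ≤ Real.exp (P * x * (Real.exp l - 1) - l * K) := by
    have := sum_bernoulliWeight_card_gt_le (α := Fin P) h0 h1 hl K
    rw [Fintype.card_fin] at this
    refine le_trans (le_of_eq (Finset.sum_congr rfl fun s _ => ?_)) this
    simp only [hbig, hw]; split_ifs <;> simp
  have hcuts : ∑ T ∈ F, ∑ S : Fin n → Finset (Fin P), (∏ i, w (S i)) * cut T S ≤
      ∑ T ∈ F, binomialBelow q (x ^ 2 * (1 - x) ^ (n - 2)) P 0 ^ (T.card * (n - T.card)) :=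
    Finset.sum_le_sum fun T _ => by convert sum_bernoulliWeight_cut_le h0 h1 q T
  have := (Finset.sum_le_sum fun S (_ : S ∈ Finset.univ) => hpoint S).trans hdom
  rw [hsum] at this
  have hn := mul_le_mul_of_nonneg_left hch (Nat.cast_nonneg (α := ℝ) n)
  linarith

/-- The union bound over all cuts, for the connectivity threshold of independent edges. -/
theorem sum_cuts_le {n : ℕ} (hn : 0 < n) {a b t L : ℝ} (ha : 1 ≤ a) (ht1 : t ≤ 1)
    (hL : 0 ≤ L) (hb0 : 0 ≤ b) (hb : b ≤ Real.exp (-(a * L / n))) :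
    ∑ T : Finset (Fin n) with T.Nonempty ∧ 2 * T.card ≤ n, b ^ (T.card * (n - T.card)) ≤
      (Real.exp (n * Real.exp (-(a * t * L))) - 1) +
        Real.exp (n * (Real.log 2 - (1 - t) / 2 * L)) := by
  have hn' : (0 : ℝ) < n := by exact_mod_cast hn
  set y := Real.exp (-(a * t * L)) with hy
  set z := Real.exp (-((1 - t) / 2 * L * n)) with hz
  have hterm : ∀ T : Finset (Fin n), 2 * T.card ≤ n →
      b ^ (T.card * (n - T.card)) ≤ y ^ T.card + z := by
    intro T hT
    have hTn : T.card ≤ n := by omega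
    have hT' : 2 * (T.card : ℝ) ≤ n := by exact_mod_cast hT
    have hr0 : (0 : ℝ) ≤ T.card := Nat.cast_nonneg _
    have h1 : b ^ (T.card * (n - T.card)) ≤
        Real.exp (-(a * L / n * (T.card * (n - T.card)))) := by
      calc _ ≤ Real.exp (-(a * L / n)) ^ (T.card * (n - T.card)) := pow_le_pow_left₀ hb0 hb _
        _ = _ := by
          rw [← Real.exp_nat_mul]
          push_cast [Nat.cast_sub hTn]
          ring_nf
    refine h1.trans ?_
    have haL : 0 ≤ a * L / n := by positivity
    -- Small sets have `n - |T| ≥ t * n`, giving `y ^ |T|`. For the others `n - |T| ≥ n / 2` makes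
    -- one term so small that it survives the crude count of `2 ^ n` sets.
    by_cases hc : (T.card : ℝ) ≤ (1 - t) * n
    · have : Real.exp (-(a * L / n * (T.card * (n - T.card)))) ≤ y ^ T.card := by
        rw [hy, ← Real.exp_nat_mul, Real.exp_le_exp]
        have h2 : a * L / n * (T.card * (t * n)) ≤ a * L / n * (T.card * (n - T.card)) :=
          mul_le_mul_of_nonneg_left (mul_le_mul_of_nonneg_left (by linarith) hr0) haL
        have h3 : a * L / n * (T.card * (t * n)) = T.card * (a * t * L) := by field_simp
        linarith
      exact this.trans (le_add_of_nonneg_right (Real.exp_pos _).le)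
    · push Not at hc
      have : Real.exp (-(a * L / n * (T.card * (n - T.card)))) ≤ z := by
        rw [hz, Real.exp_le_exp]
        have h2 : a * L / n * (((1 - t) * n) * (n / 2)) ≤ a * L / n * (T.card * (n - T.card)) :=
          mul_le_mul_of_nonneg_left
            (mul_le_mul hc.le (by linarith) (by positivity) hr0) haL
        have h3 : a * L / n * (((1 - t) * n) * (n / 2)) = a * ((1 - t) / 2 * L * n) := by
          field_simp
        have h4 : 0 ≤ (1 - t) / 2 * L * n := by
          have : 0 ≤ 1 - t := sub_nonneg.2 ht1
          positivity
        nlinarith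
      exact this.trans (le_add_of_nonneg_left (by positivity))
  calc _ ≤ ∑ T : Finset (Fin n) with T.Nonempty ∧ 2 * T.card ≤ n, (y ^ T.card + z) :=
        Finset.sum_le_sum fun T hT => hterm T (Finset.mem_filter.1 hT).2.2
    -- Leaving out the empty set produces the `- 1` without which the bound would not tend to 0.
    _ ≤ ∑ T ∈ Finset.univ.erase (∅ : Finset (Fin n)), (y ^ T.card + z) := by
        refine Finset.sum_le_sum_of_subset_of_nonneg ?_ fun T _ _ => by positivity
        intro T hT
        simpa [Finset.nonempty_iff_ne_empty] using (Finset.mem_filter.1 hT).2.1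
    _ ≤ ((y + 1) ^ n - 1) + 2 ^ n * z := by
        have h1 := Fintype.sum_pow_mul_eq_add_pow (Fin n) y 1
        have h2 := Finset.add_sum_erase Finset.univ (fun T : Finset (Fin n) => y ^ T.card + z)
          (Finset.mem_univ ∅)
        have h3 : ∑ T : Finset (Fin n), (y ^ T.card + z) = (y + 1) ^ n + 2 ^ n * z := by
          simp only [one_pow, mul_one, Fintype.card_fin] at h1
          rw [Finset.sum_add_distrib, h1]
          simp
        simp only [Finset.card_empty, pow_zero] at h2
        have : 0 ≤ z := (Real.exp_pos _).le
        linarith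
    _ ≤ _ := by
        have h1 : (y + 1) ^ n ≤ Real.exp (n * y) := by
          rw [Real.exp_nat_mul]
          exact pow_le_pow_left₀ (by positivity) (Real.add_one_le_exp _) _
        have h2 : 2 ^ n * z = Real.exp (n * (Real.log 2 - (1 - t) / 2 * L)) := by
          rw [mul_sub, Real.exp_sub, Real.exp_nat_mul, Real.exp_log two_pos, hz, Real.exp_neg]
          rw [div_eq_mul_inv]
          ring_nf
        linarith

/-! ### Edge probability, choice of parameters and the limit -/

/-- A lower bound for the edge probability in the Bernoulli model. -/
theorem binomialBelow_le_exp {q n K P : ℕ} {t : ℝ} (ht0 : 0 < t) (ht1 : t < 1) (hP : 0 < P)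
    (hnK : (n : ℝ) * K ≤ (1 - t) * P) (hKK : (K : ℝ) ^ 2 ≤ (1 - t) * P) (hK : K ≤ P)
    (hqP : q ≤ (1 - t) * P) :
    binomialBelow q ((t * K / P) ^ 2 * (1 - t * K / P) ^ (n - 2)) P 0 ≤
      Real.exp (-(t ^ (4 * q + 1) * (1 / (q.factorial : ℝ) * ((K : ℝ) ^ (2 * q) / (P : ℝ) ^ q))))
      := by
  have hP' : (0 : ℝ) < P := by exact_mod_cast hP
  have hK' : (K : ℝ) ≤ P := by exact_mod_cast hK
  have hK0 : (0 : ℝ) ≤ K := Nat.cast_nonneg _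
  set x : ℝ := t * K / P with hx
  have hxK : x ≤ K / P := by
    rw [hx]; gcongr; nlinarith
  have hx0 : 0 ≤ x := by positivity
  have hx1 : x ≤ 1 := hxK.trans (div_le_one_of_le₀ hK' hP'.le)
  set p : ℝ := x ^ 2 * (1 - x) ^ (n - 2) with hp
  have h1x : 0 ≤ 1 - x := sub_nonneg.2 hx1
  have hp0 : 0 ≤ p := by positivity
  have hpx : p ≤ x ^ 2 := mul_le_of_le_one_right (by positivity) (pow_le_one₀ h1x (by linarith))
  have hp1 : p ≤ 1 := hpx.trans (pow_le_one₀ hx0 hx1)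
  have hpl : t ^ 3 * (K ^ 2 / P ^ 2) ≤ p := by
    have h1 : 1 - n * x ≤ (1 - x) ^ (n - 2) := by
      have h2 := one_add_mul_le_pow (a := -x) (by linarith) n
      have h3 : (1 - x) ^ n ≤ (1 - x) ^ (n - 2) :=
        pow_le_pow_of_le_one h1x (by linarith) (Nat.sub_le _ _)
      have h4 : 1 + (n : ℝ) * -x = 1 - n * x := by ring
      have h5 : 1 + -x = 1 - x := by ring
      rw [h4, h5] at h2
      exact h2.trans h3
    have h2 : (n : ℝ) * x ≤ 1 - t := by
      calc (n : ℝ) * x ≤ n * (K / P) := by gcongr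
        _ = n * K / P := by ring
        _ ≤ 1 - t := by rwa [div_le_iff₀ hP']
    calc t ^ 3 * (K ^ 2 / P ^ 2) = x ^ 2 * t := by rw [hx]; ring
      _ ≤ p := mul_le_mul_of_nonneg_left (by linarith) (by positivity)
  have hpow : t ≤ (1 - p) ^ P := by
    have h2 := one_add_mul_le_pow (a := -p) (by linarith) P
    have h3 : P * p ≤ 1 - t := by
      calc P * p ≤ P * (K / P) ^ 2 := by
            refine mul_le_mul_of_nonneg_left (hpx.trans ?_) hP'.le
            exact pow_le_pow_left₀ hx0 hxK 2
        _ = K ^ 2 / P := by field_simp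
        _ ≤ 1 - t := by rwa [div_le_iff₀ hP']
    have h5 : 1 + -p = 1 - p := by ring
    rw [h5] at h2
    linarith
  have hchoose : (t * P) ^ q / q.factorial ≤ P.choose q := by
    have hqP' : (q : ℝ) ≤ P := hqP.trans (by nlinarith)
    have hqP'' : q ≤ P := by exact_mod_cast hqP'
    have h := Nat.pow_le_choose (α := ℝ) q P
    refine le_trans ?_ h
    gcongr
    rw [Nat.cast_sub (by omega)]
    push_cast
    linarith
  refine (binomialBelow_le hp0 hp1 P q 0 (zero_add q)).trans ?_
  refine le_trans ?_ (Real.one_sub_le_exp_neg _)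
  refine sub_le_sub_left ?_ 1
  -- The exponent `4 * q + 1` collects `q` from the binomial coefficient, `3 * q` from `p ^ q` and 1
  -- from `(1 - p) ^ P`.
  calc _ = (t * P) ^ q / q.factorial * (t ^ 3 * (K ^ 2 / P ^ 2)) ^ q * t := by
        have h2 : ((K : ℝ) ^ 2) ^ q = K ^ (2 * q) := (pow_mul _ _ _).symm
        have h3 : ((P : ℝ) ^ 2) ^ q = P ^ q * P ^ q := by
          rw [← pow_mul, mul_comm 2 q, mul_two, pow_add]
        have h4 : t ^ (4 * q + 1) = t ^ q * (t ^ 3) ^ q * t := by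
          rw [← pow_mul, ← pow_add, ← pow_succ]; congr 1; ring
        rw [mul_pow, mul_pow, div_pow, h2, h3, h4]
        field_simp
    _ ≤ _ := by gcongr

theorem exists_pow_mul_gt_one {c : ℝ} (hc : 1 < c) (m : ℕ) :
    ∃ t : ℝ, 0 < t ∧ t < 1 ∧ 1 < t ^ m * c := by
  have h : Tendsto (fun t : ℝ => t ^ m * c) (𝓝[<] 1) (𝓝 (1 ^ m * c)) :=
    (Continuous.tendsto (by fun_prop) 1).mono_left nhdsWithin_le_nhds
  rw [one_pow, one_mul] at h
  have h1 : ∀ᶠ t : ℝ in 𝓝[<] 1, t ∈ Set.Ioo (0 : ℝ) 1 := Ioo_mem_nhdsLT one_pos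
  obtain ⟨t, ht, ht'⟩ := ((h.eventually (lt_mem_nhds hc)).and h1).exists
  exact ⟨t, ht'.1, ht'.2, ht⟩

/-- Chernoff exponent per unit of `K` when the mean ring size is `t * K`. With `l = (1 - t) / 2`,
the estimate `exp l - 1 ≤ l + l ^ 2` leaves `-2 * l ^ 2 + t * l ^ 2 ≤ -l ^ 2`. -/
theorem exp_sub_one_mul_sub_le {t : ℝ} (ht0 : 0 < t) (ht1 : t < 1) :
    t * (Real.exp ((1 - t) / 2) - 1) - (1 - t) / 2 ≤ -((1 - t) ^ 2 / 4) := by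
  have h := (abs_le.1 (Real.abs_exp_sub_one_sub_id_le (x := (1 - t) / 2)
    (by rw [abs_of_nonneg (by linarith)]; linarith))).2
  nlinarith [mul_le_mul_of_nonneg_left h ht0.le, sq_nonneg (1 - t)]

theorem theorem1 (q : ℕ) (hq : 1 ≤ q) (K P : ℕ → ℕ)
    (hK : (fun n : ℕ => Real.log (n : ℝ)) =o[atTop] (fun n : ℕ => (K n : ℝ)))
    (hKP : (fun n : ℕ => (K n : ℝ)) =o[atTop]
      (fun n : ℕ => min (Real.sqrt (P n : ℝ)) ((P n : ℝ) / (n : ℝ))))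
    (c : ℝ) (hc : 1 < c)
    (hedge : ∀ᶠ n : ℕ in atTop,
      c * Real.log (n : ℝ) / (n : ℝ) ≤
        1 / (q.factorial : ℝ) * ((K n : ℝ) ^ (2 * q) / (P n : ℝ) ^ q)) :
    Tendsto (fun n : ℕ => connectedProb q n (K n) (P n)) atTop (𝓝 1) := by
  -- Of these powers of `t`, `4 * q + 1` are lost in the edge probability and one in the small cuts.
  obtain ⟨t, ht0, ht1, htc⟩ := exists_pow_mul_gt_one hc (4 * q + 2)
  set a := t ^ (4 * q + 1) * c with ha
  have hat : 1 < a * t := by rw [ha]; convert htc using 1; ring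
  have ha1 : 1 ≤ a := by
    have : 0 < a := by positivity
    nlinarith
  have ht' : 0 < 1 - t := sub_pos.2 ht1
  have hlog : Tendsto (fun n : ℕ => Real.log n) atTop atTop :=
    Real.tendsto_log_atTop.comp tendsto_natCast_atTop_atTop
  have hlim : Tendsto (fun n : ℕ => 1 - (Real.exp (-Real.log n) +
      ((Real.exp (Real.exp (-((a * t - 1) * Real.log n))) - 1) +
        Real.exp (n * (Real.log 2 - (1 - t) / 2 * Real.log n))))) atTop (𝓝 1) := by
    have e1 : Tendsto (fun n : ℕ => Real.exp (-Real.log n)) atTop (𝓝 0) :=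
      Real.tendsto_exp_neg_atTop_nhds_zero.comp hlog
    have e2 : Tendsto (fun n : ℕ => Real.exp (-((a * t - 1) * Real.log n))) atTop (𝓝 0) :=
      Real.tendsto_exp_neg_atTop_nhds_zero.comp (hlog.const_mul_atTop (by linarith))
    have e3 := (Real.continuous_exp.tendsto 0).comp e2
    have e4 : Tendsto (fun n : ℕ => (n : ℝ) * (Real.log 2 - (1 - t) / 2 * Real.log n)) atTop
        atBot := by
      refine tendsto_natCast_atTop_atTop.atTop_mul_atBot₀ ?_
      simp only [sub_eq_add_neg]
      exact tendsto_atBot_add_const_left _ _ (tendsto_neg_atTop_atBot.comp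
        (hlog.const_mul_atTop (by linarith)))
    have e5 := Real.tendsto_exp_atBot.comp e4
    have := (e1.add ((e3.sub_const 1).add e5)).const_sub 1
    simpa using this
  -- Half the Chernoff rate `(1 - t) ^ 2 / 4`: the tail is then at most `n ^ (-2)`, which leaves `1
  -- / n` after the union over nodes.
  have hKbig := hK.bound (show (0 : ℝ) < (1 - t) ^ 2 / 8 by positivity)
  have hKsmall := hKP.bound (show (0 : ℝ) < 1 - t by positivity)
  have hall : ∀ᶠ n : ℕ in atTop, K n ≤ P n ∧ 1 - (Real.exp (-Real.log n) +
      ((Real.exp (Real.exp (-((a * t - 1) * Real.log n))) - 1) +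
        Real.exp (n * (Real.log 2 - (1 - t) / 2 * Real.log n)))) ≤
      connectedProb q n (K n) (P n) := by
    filter_upwards [hKbig, hKsmall, hedge, eventually_ge_atTop 3,
      eventually_ge_atTop ⌈q / (1 - t)⌉₊] with n hb hs he hn3 hnq
    have hn0 : (0 : ℝ) < n := by exact_mod_cast (by omega : 0 < n)
    have hL : 0 < Real.log n := Real.log_pos (by exact_mod_cast (by omega : 1 < n))
    rw [Real.norm_of_nonneg hL.le, Real.norm_of_nonneg (Nat.cast_nonneg _)] at hb
    rw [Real.norm_of_nonneg (Nat.cast_nonneg _), Real.norm_of_nonneg (by positivity)] at hs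
    have hKpos : (0 : ℝ) < K n := by
      rcases (Nat.cast_nonneg (α := ℝ) (K n)).lt_or_eq with h | h
      · exact h
      · rw [← h] at hb; linarith
    have hK1 : (1 : ℝ) ≤ K n := by exact_mod_cast hKpos
    have hs1 : (K n : ℝ) ≤ (1 - t) * Real.sqrt (P n) :=
      hs.trans (mul_le_mul_of_nonneg_left (min_le_left _ _) ht'.le)
    have hs2 : (n : ℝ) * K n ≤ (1 - t) * P n := by
      have := hs.trans (mul_le_mul_of_nonneg_left (min_le_right _ _) ht'.le)
      rw [← mul_div_assoc, le_div_iff₀ hn0] at this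
      linarith
    have hP0 : (0 : ℝ) < P n := by
      have : 0 < (n : ℝ) * K n := by positivity
      exact pos_of_mul_pos_right (this.trans_le hs2) ht'.le
    have hKK : (K n : ℝ) ^ 2 ≤ (1 - t) * P n := by
      calc (K n : ℝ) ^ 2 ≤ ((1 - t) * Real.sqrt (P n)) ^ 2 := pow_le_pow_left₀ hKpos.le hs1 2
        _ = (1 - t) * ((1 - t) * P n) := by rw [mul_pow, Real.sq_sqrt hP0.le]; ring
        _ ≤ 1 * ((1 - t) * P n) := mul_le_mul_of_nonneg_right (by linarith) (by positivity)
        _ = _ := one_mul _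
    have hnP : (n : ℝ) ≤ (1 - t) * P n := by nlinarith
    have hKPn : K n ≤ P n := by
      have : (K n : ℝ) ≤ P n := by nlinarith
      exact_mod_cast this
    have hqP : (q : ℝ) ≤ (1 - t) * P n := by
      have h := Nat.le_of_ceil_le hnq
      rw [div_le_iff₀ ht'] at h
      nlinarith
    refine ⟨hKPn, ?_⟩
    have : NeZero n := ⟨by omega⟩
    have hx0 : 0 ≤ t * K n / P n := by positivity
    have hx1 : t * K n / P n ≤ 1 := by
      rw [div_le_one hP0]
      have : (K n : ℝ) ≤ P n := by exact_mod_cast hKPn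
      nlinarith
    have hmain := one_sub_connectedProb_le (q := q) (n := n) hKPn hx0 hx1
      (l := (1 - t) / 2) (by positivity)
    have hbelow := binomialBelow_le_exp (q := q) (n := n) ht0 ht1 (by exact_mod_cast hP0) hs2 hKK
      hKPn hqP
    have hbelow' : binomialBelow q ((t * K n / P n) ^ 2 * (1 - t * K n / P n) ^ (n - 2)) (P n) 0 ≤
        Real.exp (-(a * Real.log n / n)) := by
      refine hbelow.trans (Real.exp_le_exp.2 (neg_le_neg ?_))
      calc a * Real.log n / n = t ^ (4 * q + 1) * (c * Real.log n / n) := by rw [ha]; ring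
        _ ≤ _ := mul_le_mul_of_nonneg_left he (by positivity)
    have hx1' : 0 ≤ 1 - t * K n / P n := sub_nonneg.2 hx1
    have hcuts := sum_cuts_le (n := n) (by omega) ha1 ht1.le hL.le
      (binomialBelow_nonneg (q := q) (by positivity)
        (mul_le_one₀ (pow_le_one₀ hx0 hx1) (by positivity) (pow_le_one₀ hx1' (by linarith))) _ _)
      hbelow'
    have hexp : (n : ℝ) * Real.exp (-(a * t * Real.log n)) =
        Real.exp (-((a * t - 1) * Real.log n)) := by
      nth_rewrite 1 [← Real.exp_log hn0]
      rw [← Real.exp_add]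
      ring_nf
    rw [hexp] at hcuts
    have hchern : (n : ℝ) * Real.exp (P n * (t * K n / P n) * (Real.exp ((1 - t) / 2) - 1) -
        (1 - t) / 2 * K n) ≤ Real.exp (-Real.log n) := by
      nth_rewrite 1 [← Real.exp_log hn0]
      rw [← Real.exp_add, Real.exp_le_exp, mul_div_cancel₀ _ hP0.ne']
      have := mul_le_mul_of_nonneg_right (exp_sub_one_mul_sub_le ht0 ht1) hKpos.le
      nlinarith
    linarith
  refine tendsto_of_tendsto_of_tendsto_of_le_of_le' hlim tendsto_const_nhds
    (hall.mono fun n h => h.2) (hall.mono fun n h => connectedProb_le_one h.1)
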